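/- Let $n,m\ge 1$, let $A_1,B_1,C_1\in\mathbb{R}^{n\times n}$ and $A_2,B_2,C_2\in\mathbb{R}^{m\times m}$ be symmetric, let $C_2$ and $C_1\otimes B_2-B_1\otimes C_2$ (Kronecker products) be positive definite and let $C_1$ be negative definite. A solution of the two-parameter eigenvalue problem is a tuple $(\lambda,\mu,u,v)$ with $u,v\neq 0$ and $$(A_1+\lambda B_1+\mu C_1)u=0,\qquad (A_2+\lambda B_2+\mu C_2)v=0;$$ then $(\lambda,\mu)$ is called an eigenvalue and $u\otimes v=uv^\top$ an eigenvector. The eigenvalue $(\lambda,\mu)\in\mathbb{R}^2$ has index $(i,j)$ if $0$ is the $i$-th smallest eigenvalue (counted with multiplicity) of $A_1+\lambda B_1+\mu C_1$ and the $j$-th smallest eigenvalue of $A_2+\lambda B_2+\mu C_2$; it is simple if its eigenvector $u\otimes v$ is unique up to scalar multiples. Write $a_1(u)=u^\top A_1u$, $b_1(u)=u^\top B_1u$, $c_1(u)=u^\top C_1u$, $a_2(v)=v^\top A_2v$, $b_2(v)=v^\top B_2v$, $c_2(v)=v^\top C_2v$. The alternating algorithm with input index $(i,j)$ starts from an arbitrary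 nonzero $u_0\in\mathbb{R}^n$ and, for $k=1,2,\dots$, chooses an eigenvector $v_k$ corresponding to the $j$-th smallest eigenvalue of the generalized eigenvalue problem $$\bigl(a_1(u_{k-1})C_2-c_1(u_{k-1})A_2\bigr)v=t\,\bigl(c_1(u_{k-1})B_2-b_1(u_{k-1})C_2\bigr)v,$$ and then an eigenpair $(u_k,\lambda_k)$ corresponding to the $i$-th smallest eigenvalue of $$\bigl(c_2(v_k)A_1-a_2(v_k)C_1\bigr)u=t\,\bigl(b_2(v_k)C_1-c_2(v_k)B_1\bigr)u.$$ Put $\mu_k=-\dfrac{a_2(v_k)+\lambda_k b_2(v_k)}{c_2(v_k)}$. Theorem. Let $(i,j)=(1,1)$ or $(i,j)=(n,m)$, and assume that the eigenvalue $(\lambda,\mu)$ of index $(i,j)$ is simple. Then, for every sequence generated by the algorithm with input index $(i,j)$, the iterates converge up to normalization and sign to a solution of the two-parameter eigenvalue problem with this eigenvalue: there are $u\in\mathbb{R}^n$, $v\in\mathbb{R}^m$ with $\|u\|_2=\|v\|_2=1$ and signs $s_k,s_k'\in\{1,-1\}$ such that $(\lambda,\mu,u,v)$ is a solution and, as $k\to\infty$,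 $$s_k\frac{u_k}{\|u_k\|_2}\to u,\qquad s_k'\frac{v_k}{\|v_k\|_2}\to v,\qquad \lambda_k\to\lambda,\qquad \mu_k\to\mu.$$ -/

import Mathlib

open Filter Topology Matrix
open scoped Kronecker

/-- The quadratic form `xᵀ M x`. -/
def quadForm {d : ℕ} (M : Matrix (Fin d) (Fin d) ℝ) (x : Fin d → ℝ) : ℝ := x ⬝ᵥ (M *ᵥ x)

/-- `t` is the `i`-th smallest eigenvalue (one-based, `1 ≤ i ≤ d`, counted with multiplicity) of the
symmetric right definite generalized eigenvalue problem `A x = t B x`: there are eigenvalues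
`e₁ ≤ … ≤ e_d` with a `B`-orthonormal basis of corresponding eigenvectors, and `e_i = t`. -/
def IsKthSmallestEigenvalue {d : ℕ} (A B : Matrix (Fin d) (Fin d) ℝ) (i : ℕ) (t : ℝ) : Prop :=
  ∃ (e : Fin d → ℝ) (x : Fin d → Fin d → ℝ),
    Monotone e ∧
    (∀ k l, x k ⬝ᵥ (B *ᵥ x l) = if k = l then 1 else 0) ∧
    (∀ k, A *ᵥ x k = e k • (B *ᵥ x k)) ∧
    ∃ k : Fin d, (k : ℕ) + 1 = i ∧ e k = t

/-- `t` is the `i`-th smallest eigenvalue of `A x = t B x`, and `x` is an eigenvector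
corresponding to it. -/
def IsKthSmallestEigenpair {d : ℕ} (A B : Matrix (Fin d) (Fin d) ℝ) (i : ℕ) (t : ℝ)
    (x : Fin d → ℝ) : Prop :=
  IsKthSmallestEigenvalue A B i t ∧ x ≠ 0 ∧ A *ᵥ x = t • (B *ᵥ x)

/-- The matrices of a two-parameter eigenvalue problem
`(A₁ + lam B₁ + mu C₁) u = 0`, `(A₂ + lam B₂ + mu C₂) v = 0`. -/
structure TwoParamProblem (n m : ℕ) where
  A₁ : Matrix (Fin n) (Fin n) ℝ
  B₁ : Matrix (Fin n) (Fin n) ℝ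
  C₁ : Matrix (Fin n) (Fin n) ℝ
  A₂ : Matrix (Fin m) (Fin m) ℝ
  B₂ : Matrix (Fin m) (Fin m) ℝ
  C₂ : Matrix (Fin m) (Fin m) ℝ

namespace TwoParamProblem

variable {n m : ℕ}

/-- All matrices are symmetric, `C₂` and `C₁ ⊗ B₂ - B₁ ⊗ C₂` are positive definite, and `C₁` is
negative definite. -/
structure Admissible (P : TwoParamProblem n m) : Prop where
  symm_A₁ : P.A₁.IsSymm
  symm_B₁ : P.B₁.IsSymm
  symm_C₁ : P.C₁.IsSymm
  symm_A₂ : P.A₂.IsSymm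
  symm_B₂ : P.B₂.IsSymm
  symm_C₂ : P.C₂.IsSymm
  posDef_C₂ : P.C₂.PosDef
  negDef_C₁ : (-P.C₁).PosDef
  posDef_kronecker : (P.C₁ ⊗ₖ P.B₂ - P.B₁ ⊗ₖ P.C₂).PosDef

/-- `A₁ + lam B₁ + mu C₁`. -/
def pencil₁ (P : TwoParamProblem n m) (lam mu : ℝ) : Matrix (Fin n) (Fin n) ℝ :=
  P.A₁ + lam • P.B₁ + mu • P.C₁

/-- `A₂ + lam B₂ + mu C₂`. -/
def pencil₂ (P : TwoParamProblem n m) (lam mu : ℝ) : Matrix (Fin m) (Fin m) ℝ :=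
  P.A₂ + lam • P.B₂ + mu • P.C₂

/-- `(lam, mu, u, v)` is a solution of the two-parameter eigenvalue problem. -/
def IsSolution (P : TwoParamProblem n m) (lam mu : ℝ) (u : Fin n → ℝ) (v : Fin m → ℝ) : Prop :=
  u ≠ 0 ∧ v ≠ 0 ∧ P.pencil₁ lam mu *ᵥ u = 0 ∧ P.pencil₂ lam mu *ᵥ v = 0

/-- `X` is an eigenvector `u ⊗ v` (that is, the rank-one matrix `u vᵀ`) of the two-parameter
eigenvalue problem with eigenvalue `(lam, mu)`. -/
def IsEigenvector (P : TwoParamProblem n m) (lam mu : ℝ) (X : Matrix (Fin n) (Fin m) ℝ) : Prop :=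
  ∃ u v, P.IsSolution lam mu u v ∧ X = vecMulVec u v

/-- The eigenvalue `(lam, mu)` has index `(i, j)`: zero is the `i`-th smallest eigenvalue of
`A₁ + lam B₁ + mu C₁` and the `j`-th smallest eigenvalue of `A₂ + lam B₂ + mu C₂`. -/
def HasIndex (P : TwoParamProblem n m) (lam mu : ℝ) (i j : ℕ) : Prop :=
  IsKthSmallestEigenvalue (P.pencil₁ lam mu) 1 i 0 ∧
    IsKthSmallestEigenvalue (P.pencil₂ lam mu) 1 j 0

/-- `(lam, mu)` is a simple eigenvalue: it has an eigenvector `u ⊗ v`, and only one up to scalar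
multiples, so that the eigenvectors span a one-dimensional space. -/
def IsSimpleEigenvalue (P : TwoParamProblem n m) (lam mu : ℝ) : Prop :=
  (∃ X, P.IsEigenvector lam mu X) ∧
    ∀ X Y, P.IsEigenvector lam mu X → P.IsEigenvector lam mu Y → ∃ c : ℝ, Y = c • X

/-- `(u_k)`, `(v_k)`, `(lam_k)` are generated by the alternating algorithm with input index `(i, j)`:
`u_0` is any nonzero vector; `v_{k+1}` is an eigenvector for the `j`-th smallest eigenvalue of
`(a₁ C₂ - c₁ A₂) v = t (c₁ B₂ - b₁ C₂) v`, the coefficients being taken at `u_k`; and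
`(u_{k+1}, lam_{k+1})` is an eigenpair for the `i`-th smallest eigenvalue of
`(c₂ A₁ - a₂ C₁) u = t (b₂ C₁ - c₂ B₁) u`, the coefficients being taken at `v_{k+1}`.
The eigenvectors may be scaled arbitrarily, and any eigenvector may be taken if the eigenvalue of a
subproblem is multiple. The entries `v 0` and `lam 0` play no role. -/
structure IsAlternatingRun (P : TwoParamProblem n m) (i j : ℕ)
    (u : ℕ → Fin n → ℝ) (v : ℕ → Fin m → ℝ) (lam : ℕ → ℝ) : Prop where
  init : u 0 ≠ 0
  step_v : ∀ k, ∃ t : ℝ, IsKthSmallestEigenpair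
    (quadForm P.A₁ (u k) • P.C₂ - quadForm P.C₁ (u k) • P.A₂)
    (quadForm P.C₁ (u k) • P.B₂ - quadForm P.B₁ (u k) • P.C₂) j t (v (k + 1))
  step_u : ∀ k, IsKthSmallestEigenpair
    (quadForm P.C₂ (v (k + 1)) • P.A₁ - quadForm P.A₂ (v (k + 1)) • P.C₁)
    (quadForm P.B₂ (v (k + 1)) • P.C₁ - quadForm P.C₂ (v (k + 1)) • P.B₁) i
    (lam (k + 1)) (u (k + 1))

/-- The second component `mu = -(a₂(v) + lam b₂(v)) / c₂(v)` returned by the algorithm. -/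
noncomputable def outputMu (P : TwoParamProblem n m) (lam : ℝ) (v : Fin m → ℝ) : ℝ :=
  -((quadForm P.A₂ v + lam * quadForm P.B₂ v) / quadForm P.C₂ v)

end TwoParamProblem

/-- The vector `x` divided by its Euclidean norm. -/
noncomputable def unitVector {d : ℕ} (x : Fin d → ℝ) : Fin d → ℝ := (√(x ⬝ᵥ x))⁻¹ • x

/-- The sequence `x` converges to the unit vector `y` up to normalization and sign flips. -/
def ConvergesProjectively {d : ℕ} (x : ℕ → Fin d → ℝ) (y : Fin d → ℝ) : Prop :=
  y ⬝ᵥ y = 1 ∧ ∃ s : ℕ → ℝ, (∀ k, s k = 1 ∨ s k = -1) ∧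
    Tendsto (fun k => s k • unitVector (x k)) atTop (𝓝 y)

/-! ### Quadratic forms -/

/-! Alternating minimization of the Rayleigh quotient `rayleighNum / rayleighDen` over rank-one `x ⊗
y`: for index (1,1) each half step minimizes it in one factor. Everything rests on the identity
`rayleighNum_sub`. At the eigenvalue of index (1,1) both pencils are positive semidefinite, and c₂ >
0 > c₁, so the identity shows that `lam` is the minimum and is attained exactly at solutions. The
computed values decrease to some `L`, and every cluster point of the normalized iterates minimizes
in each factor separately, with value `L`. Such a point is a global minimizer
(`mul_rayleighDen_le_of_partial_min`): a suitable second parameter makes both pencils semidefinite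
at `L`, and the identity applies again. So `L = lam`, cluster points are solutions, and simplicity
makes them unique up to sign. Index (n,m) is the same statement after negating A₁ and A₂. -/

theorem real_dotProduct_self_nonneg {d : ℕ} (x : Fin d → ℝ) : 0 ≤ x ⬝ᵥ x :=
  Finset.sum_nonneg fun _ _ => mul_self_nonneg _

theorem quadForm_sub {d : ℕ} (M N : Matrix (Fin d) (Fin d) ℝ) (x : Fin d → ℝ) :
    quadForm (M - N) x = quadForm M x - quadForm N x := by
  simp [quadForm, Matrix.sub_mulVec, dotProduct_sub]

theorem quadForm_add {d : ℕ} (M N : Matrix (Fin d) (Fin d) ℝ) (x : Fin d → ℝ) :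
    quadForm (M + N) x = quadForm M x + quadForm N x := by
  simp [quadForm, Matrix.add_mulVec, dotProduct_add]

theorem quadForm_neg {d : ℕ} (M : Matrix (Fin d) (Fin d) ℝ) (x : Fin d → ℝ) :
    quadForm (-M) x = -quadForm M x := by
  simp [quadForm, Matrix.neg_mulVec]

theorem quadForm_smul {d : ℕ} (c : ℝ) (M : Matrix (Fin d) (Fin d) ℝ) (x : Fin d → ℝ) :
    quadForm (c • M) x = c * quadForm M x := by
  simp [quadForm, Matrix.smul_mulVec]

theorem quadForm_smul_vec {d : ℕ} (M : Matrix (Fin d) (Fin d) ℝ) (c : ℝ) (x : Fin d → ℝ) :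
    quadForm M (c • x) = c ^ 2 * quadForm M x := by
  simp [quadForm, Matrix.mulVec_smul]; ring

theorem continuous_quadForm {d : ℕ} (M : Matrix (Fin d) (Fin d) ℝ) : Continuous (quadForm M) := by
  unfold quadForm
  exact continuous_id.dotProduct (continuous_const.matrix_mulVec continuous_id)

theorem tendsto_quadForm {d : ℕ} (M : Matrix (Fin d) (Fin d) ℝ) {ι : Type*} {l : Filter ι}
    {a : ι → Fin d → ℝ} {x : Fin d → ℝ} (ha : Tendsto a l (𝓝 x)) :
    Tendsto (fun k => quadForm M (a k)) l (𝓝 (quadForm M x)) :=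
  ((continuous_quadForm M).tendsto x).comp ha

theorem Matrix.PosDef.quadForm_pos {d : ℕ} {M : Matrix (Fin d) (Fin d) ℝ} (hM : M.PosDef)
    {x : Fin d → ℝ} (hx : x ≠ 0) : 0 < quadForm M x := by
  simpa [quadForm] using hM.dotProduct_mulVec_pos hx

theorem mulVec_eq_zero_of_quadForm_eq_zero {d : ℕ} {M : Matrix (Fin d) (Fin d) ℝ} (hM : M.IsSymm)
    (hnonneg : ∀ x, 0 ≤ quadForm M x) {x : Fin d → ℝ} (hx : quadForm M x = 0) : M *ᵥ x = 0 := by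
  have hpsd : M.PosSemidef := .of_dotProduct_mulVec_nonneg
    (by rw [Matrix.IsHermitian, conjTranspose_eq_transpose_of_trivial, hM])
    (fun y => by simpa [quadForm] using hnonneg y)
  exact (hpsd.dotProduct_mulVec_zero_iff x).1 (by simpa [quadForm] using hx)

/-! ### Extremal eigenvalues -/

/-- The `B`-orthonormal eigenvectors give coordinates `z` in which both forms are diagonal, so the
extremal eigenvalues bound the Rayleigh quotient. Symmetry and definiteness need not be assumed: the
basis already encodes them. -/
theorem IsKthSmallestEigenvalue.exists_diagonalization {d : ℕ} {A B : Matrix (Fin d) (Fin d) ℝ}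
    {i : ℕ} {t : ℝ} (h : IsKthSmallestEigenvalue A B i t) :
    ∃ (e : Fin d → ℝ) (k : Fin d), Monotone e ∧ (k : ℕ) + 1 = i ∧ e k = t ∧
      ∀ y, ∃ z : Fin d → ℝ,
        quadForm A y = ∑ l, e l * z l ^ 2 ∧ quadForm B y = ∑ l, z l ^ 2 := by
  obtain ⟨e, x, hmono, hB, hA, k, hk, hek⟩ := h
  refine ⟨e, k, hmono, hk, hek, fun y => ?_⟩
  set X : Matrix (Fin d) (Fin d) ℝ := (Matrix.of x)ᵀ with hX
  have hcol (M : Matrix (Fin d) (Fin d) ℝ) (a b : Fin d) :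
      (Xᵀ * (M * X)) a b = x a ⬝ᵥ (M *ᵥ x b) := by
    simp [hX, Matrix.mul_apply, dotProduct, Matrix.mulVec]
  have hXB : Xᵀ * (B * X) = 1 := by
    ext a b
    rw [hcol, hB, Matrix.one_apply]
  have hXA : Xᵀ * (A * X) = Matrix.diagonal e := by
    ext a b
    rw [hcol, hA, dotProduct_smul, hB, Matrix.diagonal_apply]
    by_cases hab : a = b <;> simp [hab]
  -- For square matrices a left inverse is a right inverse, so the columns of `X` span.
  have hinv : X * (Xᵀ * B) = 1 := by
    rw [mul_eq_one_comm, Matrix.mul_assoc, hXB]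
  set z := (Xᵀ * B) *ᵥ y with hz
  have hy : y = X *ᵥ z := by rw [hz, Matrix.mulVec_mulVec, hinv, Matrix.one_mulVec]
  have hquad (M : Matrix (Fin d) (Fin d) ℝ) :
      quadForm M y = z ⬝ᵥ ((Xᵀ * (M * X)) *ᵥ z) := by
    rw [hy, quadForm, ← Matrix.mulVec_mulVec, ← Matrix.mulVec_mulVec,
      Matrix.dotProduct_mulVec z, Matrix.vecMul_transpose]
  refine ⟨z, ?_, ?_⟩
  · rw [hquad, hXA]
    simp only [dotProduct, Matrix.mulVec_diagonal]
    exact Finset.sum_congr rfl fun l _ => by ring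
  · rw [hquad, hXB, Matrix.one_mulVec]
    simp only [dotProduct]
    exact Finset.sum_congr rfl fun l _ => by ring

theorem IsKthSmallestEigenvalue.mul_quadForm_le {d : ℕ} {A B : Matrix (Fin d) (Fin d) ℝ} {t : ℝ}
    (h : IsKthSmallestEigenvalue A B 1 t) (y : Fin d → ℝ) :
    t * quadForm B y ≤ quadForm A y := by
  obtain ⟨e, k, hmono, hk, rfl, hdiag⟩ := h.exists_diagonalization
  obtain ⟨z, hA, hB⟩ := hdiag y
  rw [hA, hB, Finset.mul_sum]
  refine Finset.sum_le_sum fun l _ => mul_le_mul_of_nonneg_right (hmono ?_) (sq_nonneg _)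
  rw [Fin.le_def]
  omega

theorem IsKthSmallestEigenvalue.quadForm_le_mul {d : ℕ} {A B : Matrix (Fin d) (Fin d) ℝ} {t : ℝ}
    (h : IsKthSmallestEigenvalue A B d t) (y : Fin d → ℝ) :
    quadForm A y ≤ t * quadForm B y := by
  obtain ⟨e, k, hmono, hk, rfl, hdiag⟩ := h.exists_diagonalization
  obtain ⟨z, hA, hB⟩ := hdiag y
  rw [hA, hB, Finset.mul_sum]
  refine Finset.sum_le_sum fun l _ => mul_le_mul_of_nonneg_right (hmono ?_) (sq_nonneg _)
  rw [Fin.le_def]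
  omega

theorem IsKthSmallestEigenpair.quadForm_eq {d : ℕ} {A B : Matrix (Fin d) (Fin d) ℝ} {i : ℕ}
    {t : ℝ} {x : Fin d → ℝ} (h : IsKthSmallestEigenpair A B i t x) :
    quadForm A x = t * quadForm B x := by
  simp [quadForm, h.2.2]

/-! ### Unit vectors and projective convergence -/

theorem unitVector_dotProduct_self {d : ℕ} {x : Fin d → ℝ} (hx : x ≠ 0) :
    unitVector x ⬝ᵥ unitVector x = 1 := by
  have hpos : 0 < x ⬝ᵥ x :=
    (real_dotProduct_self_nonneg x).lt_of_ne' fun h => hx (dotProduct_self_eq_zero.1 h)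
  have hsq : √(x ⬝ᵥ x) * √(x ⬝ᵥ x) = x ⬝ᵥ x := Real.mul_self_sqrt hpos.le
  have hne : √(x ⬝ᵥ x) ≠ 0 := (Real.sqrt_pos.2 hpos).ne'
  simp only [unitVector, smul_dotProduct, dotProduct_smul, smul_eq_mul]
  rw [← hsq]
  simp only [Real.sqrt_mul_self (Real.sqrt_nonneg _)]
  field_simp

theorem isCompact_dotProduct_self_eq_one (d : ℕ) :
    IsCompact {x : Fin d → ℝ | x ⬝ᵥ x = 1} := by
  refine (isCompact_univ_pi fun _ : Fin d => isCompact_Icc (a := (-1 : ℝ))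
    (b := 1)).of_isClosed_subset (isClosed_eq (continuous_id.dotProduct continuous_id) continuous_const) fun x hx a _ => ?_
  have hle : x a * x a ≤ x ⬝ᵥ x :=
    Finset.single_le_sum (f := fun b => x b * x b) (fun b _ => mul_self_nonneg _)
      (Finset.mem_univ a)
  change x ⬝ᵥ x = 1 at hx
  exact abs_le.1 (abs_le_one_iff_mul_self_le_one.2 (hle.trans_eq hx))

theorem exists_tendsto_unitVector {ι : Type*} {d : ℕ} (U : Ultrafilter ι) {x : ι → Fin d → ℝ}
    (hx : ∀ k, x k ≠ 0) :
    ∃ z : Fin d → ℝ, z ⬝ᵥ z = 1 ∧ Tendsto (fun k => unitVector (x k)) U (𝓝 z) := by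
  obtain ⟨z, hz, hle⟩ := (isCompact_dotProduct_self_eq_one d).ultrafilter_le_nhds
    (U.map fun k => unitVector (x k))
    (le_principal_iff.2 (Filter.mem_map.2
      (Filter.univ_mem' fun k => unitVector_dotProduct_self (hx k))))
  exact ⟨z, hz, hle⟩

theorem ne_zero_of_dotProduct_self_eq_one {d : ℕ} {x : Fin d → ℝ} (hx : x ⬝ᵥ x = 1) : x ≠ 0 := by
  rintro rfl
  simp at hx

/-- By compactness unit vectors converge along every ultrafilter, here to `y` or `-y`. Taking the
sign of the inner product with `y` chooses the signs independently of the ultrafilter. -/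
theorem convergesProjectively_of_ultrafilter {d : ℕ} {x : ℕ → Fin d → ℝ} {y : Fin d → ℝ}
    (hx : ∀ k, x k ≠ 0) (hy : y ⬝ᵥ y = 1)
    (h : ∀ U : Ultrafilter ℕ, (U : Filter ℕ) ≤ atTop → ∀ z,
      Tendsto (fun k => unitVector (x k)) U (𝓝 z) → ∃ c : ℝ, z = c • y) :
    ConvergesProjectively x y := by
  refine ⟨hy, fun k => if 0 ≤ y ⬝ᵥ unitVector (x k) then 1 else -1, fun k => ?_, ?_⟩
  · dsimp only
    split_ifs <;> simp
  · rw [tendsto_iff_ultrafilter]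
    intro U hU
    obtain ⟨z, hz, hlim⟩ := exists_tendsto_unitVector U hx
    obtain ⟨c, rfl⟩ := h U hU z hlim
    have hdot : Tendsto (fun k => y ⬝ᵥ unitVector (x k)) U (𝓝 c) := by
      have := (continuous_const.dotProduct continuous_id :
        Continuous fun w : Fin d → ℝ => y ⬝ᵥ w).tendsto (c • y) |>.comp hlim
      simpa [hy, Function.comp_def] using this
    have hc : c * c = 1 := by simpa [hy] using hz
    rcases mul_self_eq_one_iff.1 hc with rfl | rfl
    · refine (tendsto_congr' ?_).2 (by simpa using hlim)
      filter_upwards [hdot.eventually (lt_mem_nhds one_pos)] with k hk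
      simp [hk.le]
    · refine (tendsto_congr' ?_).2 (by simpa using hlim.neg)
      filter_upwards [hdot.eventually (gt_mem_nhds (neg_lt_zero.2 one_pos))] with k hk
      simp [not_le.2 hk]

theorem ConvergesProjectively.of_succ {d : ℕ} {x : ℕ → Fin d → ℝ} {y : Fin d → ℝ}
    (h : ConvergesProjectively (fun k => x (k + 1)) y) : ConvergesProjectively x y := by
  obtain ⟨hy, s, hs, hlim⟩ := h
  -- Truncated subtraction reuses `s 0` at index 0, which does not affect the limit.
  refine ⟨hy, fun k => s (k - 1), fun k => hs _, ?_⟩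
  rw [← tendsto_add_atTop_iff_nat 1]
  simpa using hlim

namespace TwoParamProblem

variable {n m : ℕ}

/-! ### The Rayleigh quotient on rank-one matrices -/

/-- Numerator of the Rayleigh quotient on `x ⊗ y`. -/
def rayleighNum (P : TwoParamProblem n m) (x : Fin n → ℝ) (y : Fin m → ℝ) : ℝ :=
  quadForm P.A₁ x * quadForm P.C₂ y - quadForm P.C₁ x * quadForm P.A₂ y

/-- Denominator of the Rayleigh quotient on `x ⊗ y`. -/
def rayleighDen (P : TwoParamProblem n m) (x : Fin n → ℝ) (y : Fin m → ℝ) : ℝ :=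
  quadForm P.C₁ x * quadForm P.B₂ y - quadForm P.B₁ x * quadForm P.C₂ y

theorem quadForm_pencil₁ (P : TwoParamProblem n m) (lam mu : ℝ) (x : Fin n → ℝ) :
    quadForm (P.pencil₁ lam mu) x =
      quadForm P.A₁ x + lam * quadForm P.B₁ x + mu * quadForm P.C₁ x := by
  simp [pencil₁, quadForm_add, quadForm_smul]

theorem quadForm_pencil₂ (P : TwoParamProblem n m) (lam mu : ℝ) (y : Fin m → ℝ) :
    quadForm (P.pencil₂ lam mu) y =
      quadForm P.A₂ y + lam * quadForm P.B₂ y + mu * quadForm P.C₂ y := by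
  simp [pencil₂, quadForm_add, quadForm_smul]

/-- The `mu` terms cancel, so `mu` is free: it can be the true eigenvalue component or be tuned to a
given point. -/
theorem rayleighNum_sub (P : TwoParamProblem n m) (lam mu : ℝ) (x : Fin n → ℝ) (y : Fin m → ℝ) :
    P.rayleighNum x y - lam * P.rayleighDen x y =
      quadForm (P.pencil₁ lam mu) x * quadForm P.C₂ y -
        quadForm (P.pencil₂ lam mu) y * quadForm P.C₁ x := by
  rw [quadForm_pencil₁, quadForm_pencil₂, rayleighNum, rayleighDen]
  ring

theorem rayleighNum_smul (P : TwoParamProblem n m) (a b : ℝ) (x : Fin n → ℝ) (y : Fin m → ℝ) :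
    P.rayleighNum (a • x) (b • y) = a ^ 2 * b ^ 2 * P.rayleighNum x y := by
  simp only [rayleighNum, quadForm_smul_vec]
  ring

theorem rayleighDen_smul (P : TwoParamProblem n m) (a b : ℝ) (x : Fin n → ℝ) (y : Fin m → ℝ) :
    P.rayleighDen (a • x) (b • y) = a ^ 2 * b ^ 2 * P.rayleighDen x y := by
  simp only [rayleighDen, quadForm_smul_vec]
  ring

theorem tendsto_rayleighNum (P : TwoParamProblem n m) {ι : Type*} {l : Filter ι}
    {a : ι → Fin n → ℝ} {b : ι → Fin m → ℝ} {x : Fin n → ℝ} {y : Fin m → ℝ}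
    (ha : Tendsto a l (𝓝 x)) (hb : Tendsto b l (𝓝 y)) :
    Tendsto (fun k => P.rayleighNum (a k) (b k)) l (𝓝 (P.rayleighNum x y)) :=
  ((tendsto_quadForm P.A₁ ha).mul (tendsto_quadForm P.C₂ hb)).sub
    ((tendsto_quadForm P.C₁ ha).mul (tendsto_quadForm P.A₂ hb))

theorem tendsto_rayleighDen (P : TwoParamProblem n m) {ι : Type*} {l : Filter ι}
    {a : ι → Fin n → ℝ} {b : ι → Fin m → ℝ} {x : Fin n → ℝ} {y : Fin m → ℝ}
    (ha : Tendsto a l (𝓝 x)) (hb : Tendsto b l (𝓝 y)) :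
    Tendsto (fun k => P.rayleighDen (a k) (b k)) l (𝓝 (P.rayleighDen x y)) :=
  ((tendsto_quadForm P.C₁ ha).mul (tendsto_quadForm P.B₂ hb)).sub
    ((tendsto_quadForm P.B₁ ha).mul (tendsto_quadForm P.C₂ hb))

/-- Kronecker definiteness is needed only on vectors `x ⊗ y`, where the form factors; this makes
`rayleighDen` positive. -/
theorem dotProduct_kronecker_mulVec (M : Matrix (Fin n) (Fin n) ℝ) (N : Matrix (Fin m) (Fin m) ℝ)
    (x : Fin n → ℝ) (y : Fin m → ℝ) :
    (fun p : Fin n × Fin m => x p.1 * y p.2) ⬝ᵥ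
      ((M ⊗ₖ N) *ᵥ fun p : Fin n × Fin m => x p.1 * y p.2) = quadForm M x * quadForm N y := by
  have hmul : ((M ⊗ₖ N) *ᵥ fun p : Fin n × Fin m => x p.1 * y p.2) =
      fun p => (M *ᵥ x) p.1 * (N *ᵥ y) p.2 := by
    ext ⟨a, b⟩
    simp only [Matrix.mulVec, dotProduct, Fintype.sum_prod_type, Matrix.kroneckerMap_apply,
      Finset.sum_mul_sum]
    exact Finset.sum_congr rfl fun _ _ => Finset.sum_congr rfl fun _ _ => by ring
  rw [hmul, quadForm, quadForm]
  simp only [dotProduct, Fintype.sum_prod_type, Finset.sum_mul_sum]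
  exact Finset.sum_congr rfl fun _ _ => Finset.sum_congr rfl fun _ _ => by ring

theorem Admissible.rayleighDen_pos {P : TwoParamProblem n m} (hP : P.Admissible)
    {x : Fin n → ℝ} {y : Fin m → ℝ} (hx : x ≠ 0) (hy : y ≠ 0) : 0 < P.rayleighDen x y := by
  obtain ⟨a, ha⟩ := Function.ne_iff.1 hx
  obtain ⟨b, hb⟩ := Function.ne_iff.1 hy
  have hne : (fun p : Fin n × Fin m => x p.1 * y p.2) ≠ 0 :=
    Function.ne_iff.2 ⟨(a, b), mul_ne_zero ha hb⟩
  have hpos := hP.posDef_kronecker.dotProduct_mulVec_pos hne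
  rwa [star_trivial, Matrix.sub_mulVec, dotProduct_sub, dotProduct_kronecker_mulVec,
    dotProduct_kronecker_mulVec] at hpos

theorem Admissible.quadForm_C₂_pos {P : TwoParamProblem n m} (hP : P.Admissible)
    {y : Fin m → ℝ} (hy : y ≠ 0) : 0 < quadForm P.C₂ y :=
  hP.posDef_C₂.quadForm_pos hy

theorem Admissible.quadForm_C₁_neg {P : TwoParamProblem n m} (hP : P.Admissible)
    {x : Fin n → ℝ} (hx : x ≠ 0) : quadForm P.C₁ x < 0 := by
  simpa [quadForm_neg] using hP.negDef_C₁.quadForm_pos hx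

theorem Admissible.isSymm_pencil₁ {P : TwoParamProblem n m} (hP : P.Admissible) (lam mu : ℝ) :
    (P.pencil₁ lam mu).IsSymm :=
  (hP.symm_A₁.add (hP.symm_B₁.smul lam)).add (hP.symm_C₁.smul mu)

theorem Admissible.isSymm_pencil₂ {P : TwoParamProblem n m} (hP : P.Admissible) (lam mu : ℝ) :
    (P.pencil₂ lam mu).IsSymm :=
  (hP.symm_A₂.add (hP.symm_B₂.smul lam)).add (hP.symm_C₂.smul mu)

theorem IsSolution.rayleighNum_eq {P : TwoParamProblem n m} {lam mu : ℝ} {x : Fin n → ℝ}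
    {y : Fin m → ℝ} (h : P.IsSolution lam mu x y) :
    P.rayleighNum x y = lam * P.rayleighDen x y := by
  have := P.rayleighNum_sub lam mu x y
  simp only [quadForm, h.2.2.1, h.2.2.2, dotProduct_zero, zero_mul, sub_zero] at this
  linarith

theorem IsSolution.outputMu_eq {P : TwoParamProblem n m} (hP : P.Admissible) {lam mu : ℝ}
    {x : Fin n → ℝ} {y : Fin m → ℝ} (h : P.IsSolution lam mu x y) : P.outputMu lam y = mu := by
  have hpos := hP.quadForm_C₂_pos h.2.1
  have hy := P.quadForm_pencil₂ lam mu y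
  rw [quadForm, h.2.2.2, dotProduct_zero] at hy
  rw [outputMu, neg_eq_iff_eq_neg, div_eq_iff hpos.ne']
  linarith

theorem outputMu_smul (P : TwoParamProblem n m) (lam : ℝ) {c : ℝ} (hc : c ≠ 0) (y : Fin m → ℝ) :
    P.outputMu lam (c • y) = P.outputMu lam y := by
  simp only [outputMu, quadForm_smul_vec]
  rw [show c ^ 2 * quadForm P.A₂ y + lam * (c ^ 2 * quadForm P.B₂ y) =
      c ^ 2 * (quadForm P.A₂ y + lam * quadForm P.B₂ y) by ring,
    mul_div_mul_left _ _ (pow_ne_zero 2 hc)]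

theorem outputMu_unitVector (P : TwoParamProblem n m) (lam : ℝ) {y : Fin m → ℝ} (hy : y ≠ 0) :
    P.outputMu lam (unitVector y) = P.outputMu lam y := by
  refine P.outputMu_smul lam (inv_ne_zero (Real.sqrt_pos.2 ?_).ne') y
  exact (real_dotProduct_self_nonneg y).lt_of_ne' fun h => hy (dotProduct_self_eq_zero.1 h)

/-! ### Partial minimizers -/

theorem mul_rayleighDen_le {P : TwoParamProblem n m} (hP : P.Admissible) {lam mu : ℝ}
    (h₁ : ∀ x, 0 ≤ quadForm (P.pencil₁ lam mu) x) (h₂ : ∀ y, 0 ≤ quadForm (P.pencil₂ lam mu) y)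
    {x : Fin n → ℝ} {y : Fin m → ℝ} (hx : x ≠ 0) (hy : y ≠ 0) :
    lam * P.rayleighDen x y ≤ P.rayleighNum x y := by
  have hsub := P.rayleighNum_sub lam mu x y
  nlinarith [mul_nonneg (h₁ x) (hP.quadForm_C₂_pos hy).le,
    mul_nonneg (h₂ y) (neg_nonneg.2 (hP.quadForm_C₁_neg hx).le)]

theorem isSolution_of_rayleighNum_eq {P : TwoParamProblem n m} (hP : P.Admissible) {lam mu : ℝ}
    (h₁ : ∀ x, 0 ≤ quadForm (P.pencil₁ lam mu) x) (h₂ : ∀ y, 0 ≤ quadForm (P.pencil₂ lam mu) y)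
    {x : Fin n → ℝ} {y : Fin m → ℝ} (hx : x ≠ 0) (hy : y ≠ 0)
    (heq : P.rayleighNum x y = lam * P.rayleighDen x y) : P.IsSolution lam mu x y := by
  have hsub := P.rayleighNum_sub lam mu x y
  have hC₂ := hP.quadForm_C₂_pos hy
  have hC₁ := neg_pos.2 (hP.quadForm_C₁_neg hx)
  have ha := mul_nonneg (h₁ x) hC₂.le
  have hb := mul_nonneg (h₂ y) hC₁.le
  -- Two nonnegative terms with sum zero both vanish.
  have ha0 : quadForm (P.pencil₁ lam mu) x * quadForm P.C₂ y = 0 := by linarith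
  have hb0 : quadForm (P.pencil₂ lam mu) y * -quadForm P.C₁ x = 0 := by linarith
  exact ⟨hx, hy,
    mulVec_eq_zero_of_quadForm_eq_zero (hP.isSymm_pencil₁ lam mu) h₁
      ((mul_eq_zero.1 ha0).resolve_right hC₂.ne'),
    mulVec_eq_zero_of_quadForm_eq_zero (hP.isSymm_pencil₂ lam mu) h₂
      ((mul_eq_zero.1 hb0).resolve_right hC₁.ne')⟩

/-- A partial minimizer of the Rayleigh quotient is a global one. -/
theorem mul_rayleighDen_le_of_partial_min {P : TwoParamProblem n m} (hP : P.Admissible) {L : ℝ}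
    {x : Fin n → ℝ} {y : Fin m → ℝ} (hx : x ≠ 0) (hy : y ≠ 0)
    (hminx : ∀ x', L * P.rayleighDen x' y ≤ P.rayleighNum x' y)
    (hminy : ∀ y', L * P.rayleighDen x y' ≤ P.rayleighNum x y')
    (heq : P.rayleighNum x y = L * P.rayleighDen x y)
    {x' : Fin n → ℝ} {y' : Fin m → ℝ} (hx' : x' ≠ 0) (hy' : y' ≠ 0) :
    L * P.rayleighDen x' y' ≤ P.rayleighNum x' y' := by
  have hC₂ := hP.quadForm_C₂_pos hy
  have hC₁ := hP.quadForm_C₁_neg hx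
  -- `M` is chosen so that the second pencil's form vanishes at `y`; minimality in `x` then makes
  -- the first pencil semidefinite.
  set M := P.outputMu L y with hM
  have hyzero : quadForm (P.pencil₂ L M) y = 0 := by
    rw [quadForm_pencil₂, hM, outputMu]
    field_simp
    ring
  have h₁ (w : Fin n → ℝ) : 0 ≤ quadForm (P.pencil₁ L M) w := by
    have hsub := P.rayleighNum_sub L M w y
    rw [hyzero, zero_mul, sub_zero] at hsub
    exact nonneg_of_mul_nonneg_left (by linarith [hminx w]) hC₂
  have hxzero : quadForm (P.pencil₁ L M) x = 0 := by
    have hsub := P.rayleighNum_sub L M x y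
    rw [hyzero, zero_mul, sub_zero, heq, sub_self] at hsub
    exact (mul_eq_zero.1 hsub.symm).resolve_right hC₂.ne'
  -- The first form now vanishes at `x`, so minimality in `y` controls the second pencil, with the
  -- sign supplied by c₁ < 0.
  have h₂ (w : Fin m → ℝ) : 0 ≤ quadForm (P.pencil₂ L M) w := by
    have hsub := P.rayleighNum_sub L M x w
    rw [hxzero, zero_mul, zero_sub] at hsub
    exact nonneg_of_mul_nonneg_left (b := -quadForm P.C₁ x) (by linarith [hminy w]) (by linarith)
  exact mul_rayleighDen_le hP h₁ h₂ hx' hy'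

theorem eq_smul_of_vecMulVec_eq_left {x x' : Fin n → ℝ} {y : Fin m → ℝ} {c : ℝ} (hy : y ≠ 0)
    (h : vecMulVec x' y = c • vecMulVec x y) : x' = c • x := by
  obtain ⟨b, hb⟩ := Function.ne_iff.1 hy
  ext a
  have := congrFun (congrFun h a) b
  simp only [vecMulVec_apply, Matrix.smul_apply, smul_eq_mul, ← mul_assoc] at this
  exact mul_right_cancel₀ hb this

theorem eq_smul_of_vecMulVec_eq_right {x : Fin n → ℝ} {y y' : Fin m → ℝ} {c : ℝ} (hx : x ≠ 0)
    (h : vecMulVec x y' = c • vecMulVec x y) : y' = c • y := by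
  obtain ⟨a, ha⟩ := Function.ne_iff.1 hx
  ext b
  have := congrFun (congrFun h a) b
  simp only [vecMulVec_apply, Matrix.smul_apply, smul_eq_mul] at this
  exact mul_left_cancel₀ ha (by rw [this, Pi.smul_apply, smul_eq_mul]; ring)

/-! ### Convergence of alternating minimization -/

/-- The steps enter only as variational inequalities, so that the negated problem can be treated by
the same result. -/
theorem alternating_minimization_converges {P : TwoParamProblem n m} (hP : P.Admissible)
    {lam mu : ℝ} (h₁ : ∀ x, 0 ≤ quadForm (P.pencil₁ lam mu) x)
    (h₂ : ∀ y, 0 ≤ quadForm (P.pencil₂ lam mu) y) (hsimple : P.IsSimpleEigenvalue lam mu)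
    {u : ℕ → Fin n → ℝ} {v : ℕ → Fin m → ℝ} {lams : ℕ → ℝ}
    (hu : ∀ k, u k ≠ 0) (hv : ∀ k, v (k + 1) ≠ 0)
    (hstepv : ∀ k, ∃ t : ℝ, (∀ y, t * P.rayleighDen (u k) y ≤ P.rayleighNum (u k) y) ∧
      P.rayleighNum (u k) (v (k + 1)) = t * P.rayleighDen (u k) (v (k + 1)))
    (hstepu : ∀ k, ∀ x, lams (k + 1) * P.rayleighDen x (v (k + 1)) ≤
      P.rayleighNum x (v (k + 1)))
    (hequ : ∀ k, P.rayleighNum (u (k + 1)) (v (k + 1)) =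
      lams (k + 1) * P.rayleighDen (u (k + 1)) (v (k + 1))) :
    ∃ (uLim : Fin n → ℝ) (vLim : Fin m → ℝ),
      P.IsSolution lam mu uLim vLim ∧
      ConvergesProjectively u uLim ∧
      ConvergesProjectively v vLim ∧
      Tendsto lams atTop (𝓝 lam) ∧
      Tendsto (fun k => P.outputMu (lams k) (v k)) atTop (𝓝 mu) := by
  choose t htmin hteq using hstepv
  -- Testing each minimization at the previous iterate interlaces the two sequences of values.
  have hle_t (k : ℕ) : lams (k + 1) ≤ t k :=
    le_of_mul_le_mul_right ((hstepu k (u k)).trans_eq (hteq k))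
      (hP.rayleighDen_pos (hu k) (hv k))
  have ht_le (k : ℕ) : t (k + 1) ≤ lams (k + 1) :=
    le_of_mul_le_mul_right ((htmin (k + 1) (v (k + 1))).trans_eq (hequ k))
      (hP.rayleighDen_pos (hu (k + 1)) (hv k))
  have hlam_le (k : ℕ) : lam ≤ t k :=
    le_of_mul_le_mul_right ((mul_rayleighDen_le hP h₁ h₂ (hu k) (hv k)).trans_eq (hteq k))
      (hP.rayleighDen_pos (hu k) (hv k))
  have hanti : Antitone t := antitone_nat_of_succ_le fun k => (ht_le k).trans (hle_t k)
  obtain ⟨L, htL⟩ : ∃ L, Tendsto t atTop (𝓝 L) :=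
    ⟨_, tendsto_atTop_ciInf hanti ⟨lam, by rintro _ ⟨k, rfl⟩; exact hlam_le k⟩⟩
  have hlamsL : Tendsto (fun k => lams (k + 1)) atTop (𝓝 L) :=
    tendsto_of_tendsto_of_tendsto_of_le_of_le ((tendsto_add_atTop_iff_nat 1).2 htL) htL ht_le hle_t
  obtain ⟨_, u₁, v₁, hsol₁, -⟩ := hsimple.1
  -- Limits of `u k` and `v (k + 1)` suffice: minimality in `x` at `v (k + 1)` does not mention `u
  -- (k + 1)`, and both value sequences tend to `L`.
  have hcluster (U : Ultrafilter ℕ) (hU : (U : Filter ℕ) ≤ atTop) {x : Fin n → ℝ}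
      {y : Fin m → ℝ} (hxx : x ⬝ᵥ x = 1) (hyy : y ⬝ᵥ y = 1)
      (hx : Tendsto (fun k => unitVector (u k)) U (𝓝 x))
      (hy : Tendsto (fun k => unitVector (v (k + 1))) U (𝓝 y)) :
      L = lam ∧ P.IsSolution lam mu x y := by
    have hx0 := ne_zero_of_dotProduct_self_eq_one hxx
    have hy0 := ne_zero_of_dotProduct_self_eq_one hyy
    have htU := htL.mono_left hU
    have hlU := hlamsL.mono_left hU
    have hminy (w : Fin m → ℝ) : L * P.rayleighDen x w ≤ P.rayleighNum x w := by
      refine le_of_tendsto_of_tendsto' (htU.mul (P.tendsto_rayleighDen hx tendsto_const_nhds))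
        (P.tendsto_rayleighNum hx tendsto_const_nhds) fun k => ?_
      have hN := P.rayleighNum_smul (√(u k ⬝ᵥ u k))⁻¹ 1 (u k) w
      have hD := P.rayleighDen_smul (√(u k ⬝ᵥ u k))⁻¹ 1 (u k) w
      rw [one_smul] at hN hD
      rw [unitVector, hN, hD, mul_left_comm]
      exact mul_le_mul_of_nonneg_left (htmin k w) (by positivity)
    have hminx (w : Fin n → ℝ) : L * P.rayleighDen w y ≤ P.rayleighNum w y := by
      refine le_of_tendsto_of_tendsto' (hlU.mul (P.tendsto_rayleighDen tendsto_const_nhds hy))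
        (P.tendsto_rayleighNum tendsto_const_nhds hy) fun k => ?_
      have hN := P.rayleighNum_smul 1 (√(v (k + 1) ⬝ᵥ v (k + 1)))⁻¹ w (v (k + 1))
      have hD := P.rayleighDen_smul 1 (√(v (k + 1) ⬝ᵥ v (k + 1)))⁻¹ w (v (k + 1))
      rw [one_smul] at hN hD
      rw [unitVector, hN, hD, mul_left_comm]
      exact mul_le_mul_of_nonneg_left (hstepu k w) (by positivity)
    have heq : P.rayleighNum x y = L * P.rayleighDen x y := by
      refine tendsto_nhds_unique_of_eventuallyEq (P.tendsto_rayleighNum hx hy)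
        (htU.mul (P.tendsto_rayleighDen hx hy))
        (Filter.Eventually.of_forall fun k => ?_)
      simp only [unitVector, rayleighNum_smul, rayleighDen_smul, hteq k]
      ring
    have hL : L = lam := by
      refine le_antisymm ?_ (ge_of_tendsto' htL hlam_le)
      refine le_of_mul_le_mul_right ?_ (hP.rayleighDen_pos hsol₁.1 hsol₁.2.1)
      rw [← hsol₁.rayleighNum_eq]
      exact mul_rayleighDen_le_of_partial_min hP hx0 hy0 hminx hminy heq hsol₁.1 hsol₁.2.1
    exact ⟨hL, isSolution_of_rayleighNum_eq hP h₁ h₂ hx0 hy0 (hL ▸ heq)⟩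
  have hcluster' (U : Ultrafilter ℕ) (hU : (U : Filter ℕ) ≤ atTop) :
      ∃ x y, x ⬝ᵥ x = 1 ∧ y ⬝ᵥ y = 1 ∧ Tendsto (fun k => unitVector (u k)) U (𝓝 x) ∧
        Tendsto (fun k => unitVector (v (k + 1))) U (𝓝 y) ∧ L = lam ∧
        P.IsSolution lam mu x y := by
    obtain ⟨x, hxx, hx⟩ := exists_tendsto_unitVector U hu
    obtain ⟨y, hyy, hy⟩ := exists_tendsto_unitVector U hv
    exact ⟨x, y, hxx, hyy, hx, hy, hcluster U hU hxx hyy hx hy⟩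
  -- One arbitrary ultrafilter fixes the reference solution with which all others are compared.
  obtain ⟨x, y, hxx, hyy, -, -, hL, hsol⟩ := hcluster' (Ultrafilter.of atTop) (Ultrafilter.of_le _)
  subst hL
  have huconv : ConvergesProjectively u x := by
    refine convergesProjectively_of_ultrafilter hu hxx fun U hU z hz => ?_
    obtain ⟨x', y', -, -, hx', -, -, hsol'⟩ := hcluster' U hU
    obtain rfl := tendsto_nhds_unique hz hx'
    -- The two equations decouple, so `z` may be paired with the fixed `y`; simplicity then compares
    -- `z` with `x` alone.
    obtain ⟨c, hc⟩ := hsimple.2 _ _ ⟨x, y, hsol, rfl⟩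
      ⟨z, y, ⟨hsol'.1, hsol.2.1, hsol'.2.2.1, hsol.2.2.2⟩, rfl⟩
    exact ⟨c, eq_smul_of_vecMulVec_eq_left hsol.2.1 hc⟩
  have hvconv : ConvergesProjectively (fun k => v (k + 1)) y := by
    refine convergesProjectively_of_ultrafilter hv hyy fun U hU z hz => ?_
    obtain ⟨x', y', -, -, -, hy', -, hsol'⟩ := hcluster' U hU
    obtain rfl := tendsto_nhds_unique hz hy'
    obtain ⟨c, hc⟩ := hsimple.2 _ _ ⟨x, y, hsol, rfl⟩
      ⟨x, z, ⟨hsol.1, hsol'.2.1, hsol.2.2.1, hsol'.2.2.2⟩, rfl⟩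
    exact ⟨c, eq_smul_of_vecMulVec_eq_right hsol.1 hc⟩
  refine ⟨x, y, hsol, huconv, hvconv.of_succ, (tendsto_add_atTop_iff_nat 1).1 hlamsL, ?_⟩
  rw [← tendsto_add_atTop_iff_nat 1]
  obtain ⟨-, s, hs, hlim⟩ := hvconv
  have hq (M : Matrix (Fin m) (Fin m) ℝ) := tendsto_quadForm M hlim
  -- `outputMu` is homogeneous of degree zero in the vector, so normalization and signs can be
  -- inserted freely.
  have hmu : Tendsto (fun k => P.outputMu (lams (k + 1)) (s k • unitVector (v (k + 1)))) atTop
      (𝓝 (P.outputMu L y)) :=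
    (((hq _).add (hlamsL.mul (hq _))).div (hq _) (hP.quadForm_C₂_pos hsol.2.1).ne').neg
  rw [hsol.outputMu_eq hP] at hmu
  refine hmu.congr fun k => ?_
  rw [outputMu_smul, outputMu_unitVector _ _ (hv k)]
  rcases hs k with h | h <;> simp [h]

/-! ### Subproblems of the alternating algorithm -/

/-- The forms of each subproblem are the numerator and denominator with one factor frozen, so its
extremal eigenpairs optimize the quotient in the other factor. -/
theorem quadForm_stepv_left (P : TwoParamProblem n m) (x : Fin n → ℝ) (y : Fin m → ℝ) :
    quadForm (quadForm P.A₁ x • P.C₂ - quadForm P.C₁ x • P.A₂) y = P.rayleighNum x y := by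
  rw [quadForm_sub, quadForm_smul, quadForm_smul, rayleighNum]

theorem quadForm_stepv_right (P : TwoParamProblem n m) (x : Fin n → ℝ) (y : Fin m → ℝ) :
    quadForm (quadForm P.C₁ x • P.B₂ - quadForm P.B₁ x • P.C₂) y = P.rayleighDen x y := by
  rw [quadForm_sub, quadForm_smul, quadForm_smul, rayleighDen]

theorem quadForm_stepu_left (P : TwoParamProblem n m) (x : Fin n → ℝ) (y : Fin m → ℝ) :
    quadForm (quadForm P.C₂ y • P.A₁ - quadForm P.A₂ y • P.C₁) x = P.rayleighNum x y := by
  rw [quadForm_sub, quadForm_smul, quadForm_smul, rayleighNum]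
  ring

theorem quadForm_stepu_right (P : TwoParamProblem n m) (x : Fin n → ℝ) (y : Fin m → ℝ) :
    quadForm (quadForm P.B₂ y • P.C₁ - quadForm P.C₂ y • P.B₁) x = P.rayleighDen x y := by
  rw [quadForm_sub, quadForm_smul, quadForm_smul, rayleighDen]
  ring

section Run

variable {P : TwoParamProblem n m} {i j : ℕ} {u : ℕ → Fin n → ℝ} {v : ℕ → Fin m → ℝ}
  {lams : ℕ → ℝ}

theorem IsAlternatingRun.u_ne_zero (h : P.IsAlternatingRun i j u v lams) (k : ℕ) : u k ≠ 0 := by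
  cases k with
  | zero => exact h.init
  | succ k => exact (h.step_u k).2.1

theorem IsAlternatingRun.v_ne_zero (h : P.IsAlternatingRun i j u v lams) (k : ℕ) :
    v (k + 1) ≠ 0 := by
  obtain ⟨t, ht⟩ := h.step_v k
  exact ht.2.1

theorem IsAlternatingRun.rayleighNum_eq (h : P.IsAlternatingRun i j u v lams) (k : ℕ) :
    P.rayleighNum (u (k + 1)) (v (k + 1)) =
      lams (k + 1) * P.rayleighDen (u (k + 1)) (v (k + 1)) := by
  simpa only [quadForm_stepu_left, quadForm_stepu_right] using (h.step_u k).quadForm_eq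

end Run

/-! ### Reversing the order of the eigenvalues -/

/-- The problem with `A₁`, `A₂` replaced by their negatives; its eigenvalues are the negatives of
the original ones. -/
def negA (P : TwoParamProblem n m) : TwoParamProblem n m :=
  { P with A₁ := -P.A₁, A₂ := -P.A₂ }

theorem Admissible.negA {P : TwoParamProblem n m} (hP : P.Admissible) : P.negA.Admissible :=
  { hP with
    symm_A₁ := hP.symm_A₁.neg
    symm_A₂ := hP.symm_A₂.neg }

theorem pencil₁_negA (P : TwoParamProblem n m) (lam mu : ℝ) :
    P.negA.pencil₁ (-lam) (-mu) = -P.pencil₁ lam mu := by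
  simp only [pencil₁, negA, neg_smul, neg_add]

theorem pencil₂_negA (P : TwoParamProblem n m) (lam mu : ℝ) :
    P.negA.pencil₂ (-lam) (-mu) = -P.pencil₂ lam mu := by
  simp only [pencil₂, negA, neg_smul, neg_add]

theorem isSolution_negA {P : TwoParamProblem n m} {lam mu : ℝ} {x : Fin n → ℝ} {y : Fin m → ℝ} :
    P.negA.IsSolution (-lam) (-mu) x y ↔ P.IsSolution lam mu x y := by
  simp only [IsSolution, pencil₁_negA, pencil₂_negA, Matrix.neg_mulVec, neg_eq_zero]

theorem isSimpleEigenvalue_negA {P : TwoParamProblem n m} {lam mu : ℝ} :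
    P.negA.IsSimpleEigenvalue (-lam) (-mu) ↔ P.IsSimpleEigenvalue lam mu := by
  simp only [IsSimpleEigenvalue, IsEigenvector, isSolution_negA]

theorem rayleighNum_negA (P : TwoParamProblem n m) (x : Fin n → ℝ) (y : Fin m → ℝ) :
    P.negA.rayleighNum x y = -P.rayleighNum x y := by
  simp only [rayleighNum, negA, quadForm_neg]
  ring

theorem rayleighDen_negA (P : TwoParamProblem n m) (x : Fin n → ℝ) (y : Fin m → ℝ) :
    P.negA.rayleighDen x y = P.rayleighDen x y := rfl

theorem outputMu_negA (P : TwoParamProblem n m) (lam : ℝ) (y : Fin m → ℝ) :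
    P.negA.outputMu (-lam) y = -P.outputMu lam y := by
  simp only [outputMu, negA, quadForm_neg]
  ring

end TwoParamProblem

open TwoParamProblem in
theorem theorem2p7 {n m : ℕ} (P : TwoParamProblem n m) (hP : P.Admissible)
    (i j : ℕ) (hij : (i = 1 ∧ j = 1) ∨ (i = n ∧ j = m))
    (lam mu : ℝ) (hindex : P.HasIndex lam mu i j) (hsimple : P.IsSimpleEigenvalue lam mu)
    (u : ℕ → Fin n → ℝ) (v : ℕ → Fin m → ℝ) (lams : ℕ → ℝ)
    (hrun : P.IsAlternatingRun i j u v lams) :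
    ∃ (uLim : Fin n → ℝ) (vLim : Fin m → ℝ),
      P.IsSolution lam mu uLim vLim ∧
      ConvergesProjectively u uLim ∧
      ConvergesProjectively v vLim ∧
      Tendsto lams atTop (𝓝 lam) ∧
      Tendsto (fun k => P.outputMu (lams k) (v k)) atTop (𝓝 mu) := by
  rcases hij with ⟨rfl, rfl⟩ | ⟨rfl, rfl⟩
  · refine alternating_minimization_converges hP
      (fun x => by simpa using hindex.1.mul_quadForm_le x)
      (fun y => by simpa using hindex.2.mul_quadForm_le y) hsimple hrun.u_ne_zero hrun.v_ne_zero
      (fun k => ?_) (fun k x => ?_) hrun.rayleighNum_eq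
    · obtain ⟨t, ht⟩ := hrun.step_v k
      refine ⟨t, fun y => ?_, ?_⟩
      · simpa only [quadForm_stepv_left, quadForm_stepv_right] using ht.1.mul_quadForm_le y
      · simpa only [quadForm_stepv_left, quadForm_stepv_right] using ht.quadForm_eq
    · simpa only [quadForm_stepu_left, quadForm_stepu_right] using
        (hrun.step_u k).1.mul_quadForm_le x
  -- Zero is now the largest eigenvalue of both pencils. Negating A₁, A₂ flips the numerator and
  -- keeps the denominator, so maximization becomes minimization.
  · obtain ⟨x, y, hsol, hu, hv, hlam, hmu⟩ := alternating_minimization_converges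
      (lams := fun k => -lams k) hP.negA
      (fun x => by
        simpa [pencil₁_negA, quadForm_neg] using hindex.1.quadForm_le_mul x)
      (fun y => by
        simpa [pencil₂_negA, quadForm_neg] using hindex.2.quadForm_le_mul y)
      (isSimpleEigenvalue_negA.2 hsimple) hrun.u_ne_zero hrun.v_ne_zero
      (fun k => by
        obtain ⟨t, ht⟩ := hrun.step_v k
        simp only [rayleighNum_negA, rayleighDen_negA]
        refine ⟨-t, fun y => ?_, ?_⟩
        · have := ht.1.quadForm_le_mul y
          simp only [quadForm_stepv_left, quadForm_stepv_right] at this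
          linarith
        · have := ht.quadForm_eq
          simp only [quadForm_stepv_left, quadForm_stepv_right] at this
          linarith)
      (fun k x => by
        have := (hrun.step_u k).1.quadForm_le_mul x
        simp only [quadForm_stepu_left, quadForm_stepu_right] at this
        simp only [rayleighNum_negA, rayleighDen_negA]
        linarith)
      (fun k => by
        simp only [rayleighNum_negA, rayleighDen_negA, hrun.rayleighNum_eq k]
        ring)
    simp only [outputMu_negA] at hmu
    exact ⟨x, y, isSolution_negA.1 hsol, hu, hv, by simpa using hlam.neg, by simpa using hmu.neg⟩
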